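/- Theorem 2.4. Let $(\Omega,\mathcal B)$ be a measurable space and let $\mu$ be a positive measure on it whose range $\{\mu(A):A\in\mathcal B\}$ is a finite (that is, bounded) interval. Let $\nu$ be a measure on $(\Omega,\mathcal B)$ which is either a positive measure, or a signed measure (possibly extended real valued) with Radon–Nikodym derivative $\frac{d\nu}{d\mu}\in L_\infty(\mu)$, that is, $\nu(A)=\int_A g\,d\mu$ for all $A\in\mathcal B$ with some $g\in L_\infty(\mu)$. Suppose that $\nu$ satisfies the condition $(\mathcal L)$ relative to $\mu$: for all $A,B\in\mathcal B$ with $\mu(A)=\mu(B)\neq\pm\infty$ one has $\nu(A)=\nu(B)\neq\pm\infty$. Then $\nu=\alpha\mu$ for some constant $\alpha\in\mathbb R$. -/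

import Mathlib

open MeasureTheory Set
open scoped ENNReal NNReal

/-- The range `{μ(A) : A measurable}` of a positive measure. -/
def measureRange {Ω : Type*} [MeasurableSpace Ω] (μ : Measure Ω) : Set ℝ≥0∞ :=
  {x | ∃ A : Set Ω, MeasurableSet A ∧ μ A = x}

/-- A set of extended nonnegative reals is a finite interval: it is an interval
(it contains every point between two of its points) and it is bounded by a real number. -/
def IsFiniteInterval (S : Set ℝ≥0∞) : Prop :=
  S.OrdConnected ∧ ∃ c : ℝ≥0, ∀ x ∈ S, x ≤ (c : ℝ≥0∞)

/-- Condition (L) for extended real valued set functions `μ`, `ν` on the measurable sets: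
if `μ(A) = μ(B) ≠ ±∞`, then `ν(A) = ν(B) ≠ ±∞`. -/
def ConditionL {Ω : Type*} [MeasurableSpace Ω] (μ ν : Set Ω → EReal) : Prop :=
  ∀ A B : Set Ω, MeasurableSet A → MeasurableSet B →
    μ A = μ B → μ A ≠ ⊤ → μ A ≠ ⊥ → ν A = ν B ∧ ν A ≠ ⊤ ∧ ν A ≠ ⊥

/-- `dν/dμ ∈ L∞(μ)`, for a finite measure `μ` and an extended real valued signed measure `ν`:
some `g ∈ L∞(μ)` satisfies `ν(A) = ∫_A g dμ` for every measurable `A`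
(such a `g` is `μ`-integrable because `μ` is finite). -/
def HasBoundedRNDeriv {Ω : Type*} [MeasurableSpace Ω] (μ : Measure Ω)
    (ν : VectorMeasure Ω EReal) : Prop :=
  ∃ g : Ω → ℝ, MemLp g ∞ μ ∧
    ∀ A : Set Ω, MeasurableSet A → ν A = ((∫ x in A, g x ∂μ : ℝ) : EReal)

/-! Remove atoms of `μ` one at a time, always a largest one, with masses `a n` and remainders `R n`;
the limit `N` of the remainders has no atoms. Since the range is an interval, Kakeya's condition
holds: `a n ≤ μ (R (n + 1))` (`atom_le`). Conversely, a greedy choice of atoms together with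
Sierpiński's theorem on `N` gives each `R n` subsets of all intermediate masses.

If `μ N > 0`, a Hahn decomposition gives `ν = c μ` on `N` (`eq_mul_of_no_atoms`). Each atom is then
matched with a set of equal mass on which the ratio is already known to be `c`.

If `μ N = 0`, write `ν = φ ∘ μ`. Kakeya's condition makes a lower bound `i z ≤ φ z` near zero a
bound on all increments (`growth`), so `φ` is monotone and, by Lebesgue, differentiable at some
interior point. A set of that mass contains or misses each atom, so `φ (a n) / a n` is a difference
quotient there and converges to some `c`. Thus `φ z` is close to `c z` near zero in ratio, and
`growth` carries this to all `z`.

A signed `ν` with bounded density becomes positive after adding a multiple of `μ`. -/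

open Filter Topology

/-- A measurable set which is an atom of `μ` or a null set. -/
def IndecomposableSet {Ω : Type*} [MeasurableSpace Ω] (μ : Measure Ω) (X : Set Ω) : Prop :=
  MeasurableSet X ∧ ∀ Y ⊆ X, MeasurableSet Y → μ.real Y = 0 ∨ μ.real (X \ Y) = 0

/-- A decreasing sequence of sets, starting with the whole space, in which every step removes
an atom of the largest possible mass. -/
structure AtomExhaustion {Ω : Type*} [MeasurableSpace Ω] (μ : Measure Ω)
    (R : ℕ → Set Ω) : Prop where
  measurable : ∀ n, MeasurableSet (R n)
  anti : Antitone R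
  zero : R 0 = univ
  indecomposable : ∀ n, IndecomposableSet μ (R n \ R (n + 1))
  largest : ∀ n, ∀ Z ⊆ R n, IndecomposableSet μ Z → μ.real Z ≤ μ.real (R n \ R (n + 1))

/-! ### Atoms, exhaustion and Sierpiński's theorem. -/

section Atoms

variable {Ω : Type*} [MeasurableSpace Ω] {μ : Measure Ω} [IsFiniteMeasure μ]

lemma measureReal_eq_inter_add_sdiff (A : Set Ω) {B : Set Ω} (hB : MeasurableSet B) :
    μ.real A = μ.real (A ∩ B) + μ.real (A \ B) :=
  (measureReal_inter_add_sdiff hB).symm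

lemma measureReal_sdiff_of_subset {A B : Set Ω} (hB : MeasurableSet B) (h : B ⊆ A) :
    μ.real (A \ B) = μ.real A - μ.real B := by
  have := measureReal_eq_inter_add_sdiff (μ := μ) A hB
  rw [inter_eq_self_of_subset_right h] at this
  linarith

lemma measureReal_inter_eq_inter_add_inter_sdiff {B C : Set Ω} (hC : MeasurableSet C)
    (h : C ⊆ B) (A : Set Ω) : μ.real (A ∩ B) = μ.real (A ∩ C) + μ.real (A ∩ (B \ C)) := by
  rw [measureReal_eq_inter_add_sdiff (A ∩ B) hC, inter_assoc,
    inter_eq_self_of_subset_right h, inter_sdiff_assoc]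

lemma IndecomposableSet.inter_eq {Z W : Set Ω} (hZ : IndecomposableSet μ Z)
    (hW : MeasurableSet W) (h : μ.real (Z ∩ W) ≠ 0) : μ.real (Z ∩ W) = μ.real Z := by
  have h1 := measureReal_eq_inter_add_sdiff (μ := μ) Z hW
  rcases hZ.2 (Z ∩ W) inter_subset_left (hZ.1.inter hW) with h2 | h2
  · exact absurd h2 h
  · rw [sdiff_self_inter] at h2
    linarith

/-- Indecomposable sets of different masses meet in a null set, so in a finite measure only finitely
many mass values exceed a given positive one. -/
lemma exists_largest_indecomposable (R : Set Ω) :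
    ∃ X ⊆ R, IndecomposableSet μ X ∧
      ∀ Z ⊆ R, IndecomposableSet μ Z → μ.real Z ≤ μ.real X := by
  by_cases h0 : ∃ Z ⊆ R, IndecomposableSet μ Z ∧ 0 < μ.real Z
  · obtain ⟨Z₀, hZ₀R, hZ₀, hpos⟩ := h0
    let V : Set ℝ := {v | ∃ Z ⊆ R, IndecomposableSet μ Z ∧ μ.real Z = v}
    choose As hAR hA hAv using fun v : V => v.2
    have hdisj : Pairwise (Function.onFun (AEDisjoint μ) As) := by
      intro v w hvw
      by_contra hne
      have hne' : μ.real (As v ∩ As w) ≠ 0 := fun h => hne (by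
        rwa [measureReal_eq_zero_iff] at h)
      have h1 := (hA v).inter_eq (hA w).1 hne'
      have h2 := (hA w).inter_eq (hA v).1 (by rwa [inter_comm])
      rw [inter_comm, h1, hAv, hAv] at h2
      exact hvw (Subtype.ext h2)
    have hfin := Measure.finite_const_le_meas_of_disjoint_iUnion₀ μ
      (ENNReal.ofReal_pos.2 hpos) (fun v => (hA v).1.nullMeasurableSet) hdisj
      (measure_ne_top _ _)
    have hmem : ∀ v : V, μ.real Z₀ ≤ v → v ∈ {i | ENNReal.ofReal (μ.real Z₀) ≤ μ (As i)} := by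
      intro v hv
      simp only [mem_ofPred_eq]
      rw [← ofReal_measureReal (μ := μ) (s := As v), hAv]
      exact ENNReal.ofReal_le_ofReal hv
    let v₀ : V := ⟨μ.real Z₀, Z₀, hZ₀R, hZ₀, rfl⟩
    obtain ⟨w, -, hw⟩ := Set.exists_max_image _ (fun v : V => (v : ℝ)) hfin
      ⟨v₀, hmem v₀ le_rfl⟩
    refine ⟨As w, hAR w, hA w, fun Z hZR hZ => ?_⟩
    rw [hAv]
    by_cases hle : μ.real Z₀ ≤ μ.real Z
    · exact hw ⟨μ.real Z, Z, hZR, hZ, rfl⟩ (hmem _ hle)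
    · exact (not_le.1 hle).le.trans (hw v₀ (hmem v₀ le_rfl))
  · push Not at h0
    refine ⟨∅, empty_subset _, ⟨MeasurableSet.empty, fun Y hY _ => Or.inl ?_⟩, fun Z hZR hZ => ?_⟩
    · rw [subset_empty_iff.1 hY, measureReal_empty]
    · rw [measureReal_empty]
      exact h0 Z hZR hZ

variable (μ) in
lemma exists_atomExhaustion : ∃ R, AtomExhaustion μ R := by
  choose f hf hfi hfl using fun R : Set Ω => exists_largest_indecomposable (μ := μ) R
  let R : ℕ → Set Ω := fun n => (fun S => S \ f S)^[n] univ
  have hsucc : ∀ n, R (n + 1) = R n \ f (R n) := fun n => Function.iterate_succ_apply' _ n univ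
  have hdiff : ∀ n, R n \ R (n + 1) = f (R n) := fun n => by
    rw [hsucc, sdiff_sdiff_cancel_left (hf _)]
  refine ⟨R, ⟨fun n => ?_, antitone_nat_of_succ_le fun n => ?_, rfl, fun n => ?_, fun n => ?_⟩⟩
  · induction n with
    | zero => exact MeasurableSet.univ
    | succ n ih => rw [hsucc]; exact ih.diff (hfi _).1
  · rw [hsucc]; exact sdiff_subset
  · rw [hdiff]; exact hfi _
  · rw [hdiff]; exact hfl _

lemma tendsto_measureReal_iInter {R : ℕ → Set Ω} (hm : ∀ n, MeasurableSet (R n))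
    (ha : Antitone R) : Tendsto (fun n => μ.real (R n)) atTop (𝓝 (μ.real (⋂ n, R n))) :=
  (ENNReal.tendsto_toReal (measure_ne_top _ _)).comp
    (tendsto_measure_iInter_atTop (fun n => (hm n).nullMeasurableSet) ha
      ⟨0, measure_ne_top _ _⟩)

lemma tendsto_measureReal_iUnion {R : ℕ → Set Ω}
    (ha : Monotone R) : Tendsto (fun n => μ.real (R n)) atTop (𝓝 (μ.real (⋃ n, R n))) :=
  (ENNReal.tendsto_toReal (measure_ne_top _ _)).comp (tendsto_measure_iUnion_atTop ha)

/-- Each step achieves at least half of the largest possible gain. The masses converge, so the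
gains, and with them the room left for improvement, tend to zero. -/
lemma exists_maximal_measure (P : Set Ω → Prop) (h0 : P ∅)
    (hU : ∀ B : ℕ → Set Ω, Monotone B → (∀ n, P (B n)) → P (⋃ n, B n)) :
    ∃ B, P B ∧ ∀ C, P C → B ⊆ C → μ.real C ≤ μ.real B := by
  have hstep : ∀ B, P B → ∃ C, P C ∧ B ⊆ C ∧
      ∀ D, P D → B ⊆ D → μ.real D - μ.real B ≤ 2 * (μ.real C - μ.real B) := by
    intro B hB
    let S : Set ℝ := {r | ∃ D, P D ∧ B ⊆ D ∧ μ.real D - μ.real B = r}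
    have hbdd : BddAbove S := by
      refine ⟨μ.real univ, ?_⟩
      rintro r ⟨D, -, -, rfl⟩
      have h1 : μ.real D ≤ μ.real univ := measureReal_mono (subset_univ _)
      have h2 : 0 ≤ μ.real B := measureReal_nonneg
      linarith
    by_cases hpos : 0 < sSup S
    · obtain ⟨r, ⟨C, hC, hBC, rfl⟩, hr⟩ := exists_lt_of_lt_csSup
        (⟨0, B, hB, subset_rfl, by simp⟩ : S.Nonempty) (half_lt_self hpos)
      refine ⟨C, hC, hBC, fun D hD hBD => ?_⟩
      have := le_csSup hbdd (show _ ∈ S from ⟨D, hD, hBD, rfl⟩)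
      linarith
    · refine ⟨B, hB, subset_rfl, fun D hD hBD => ?_⟩
      have := le_csSup hbdd (show _ ∈ S from ⟨D, hD, hBD, rfl⟩)
      linarith
  choose! g hgP hgB hg using hstep
  let B : ℕ → Set Ω := fun n => g^[n] ∅
  have hsucc : ∀ n, B (n + 1) = g (B n) := fun n => Function.iterate_succ_apply' _ n ∅
  have hP : ∀ n, P (B n) := by
    intro n
    induction n with
    | zero => exact h0
    | succ n ih => rw [hsucc]; exact hgP _ ih
  have hmono : Monotone B := monotone_nat_of_le_succ fun n => by
    rw [hsucc]; exact hgB _ (hP n)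
  have hlim := tendsto_measureReal_iUnion (μ := μ) hmono
  refine ⟨⋃ n, B n, hU B hmono hP, fun C hC hBC => ?_⟩
  have h1 : Tendsto (fun n => μ.real (B n) + 2 * (μ.real (B (n + 1)) - μ.real (B n))) atTop
      (𝓝 (μ.real (⋃ n, B n) + 2 * (μ.real (⋃ n, B n) - μ.real (⋃ n, B n)))) :=
    hlim.add (((hlim.comp (tendsto_add_atTop_nat 1)).sub hlim).const_mul 2)
  rw [sub_self, mul_zero, add_zero] at h1
  refine ge_of_tendsto' h1 fun n => ?_
  have := hg (B n) (hP n) C hC ((subset_iUnion B n).trans hBC)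
  rw [← hsucc] at this
  linarith

/-- A non-null set that is not an atom splits into two non-null pieces; keeping the lighter one at
least halves the mass. -/
lemma exists_subset_measureReal_le {N E : Set Ω}
    (hN : ∀ Z ⊆ N, IndecomposableSet μ Z → μ.real Z = 0) (hE : E ⊆ N) (hEm : MeasurableSet E)
    (hpos : 0 < μ.real E) {ε : ℝ} (hε : 0 < ε) :
    ∃ C ⊆ E, MeasurableSet C ∧ 0 < μ.real C ∧ μ.real C ≤ ε := by
  have key : ∀ n : ℕ, ∃ C ⊆ E, MeasurableSet C ∧ 0 < μ.real C ∧
      μ.real C ≤ μ.real E * (1 / 2) ^ n := by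
    intro n
    induction n with
    | zero => exact ⟨E, subset_rfl, hEm, hpos, by simp⟩
    | succ n ih =>
      obtain ⟨C, hCE, hCm, hC0, hC⟩ := ih
      have hnot : ¬ IndecomposableSet μ C := fun h => hC0.ne' (hN C (hCE.trans hE) h)
      have : ∃ Y ⊆ C, MeasurableSet Y ∧ μ.real Y ≠ 0 ∧ μ.real (C \ Y) ≠ 0 := by
        by_contra hcon
        push Not at hcon
        exact hnot ⟨hCm, fun Y hY hYm => or_iff_not_imp_left.2 (hcon Y hY hYm)⟩
      obtain ⟨Y, hYC, hYm, hY1, hY2⟩ := this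
      have hY1' := lt_of_le_of_ne measureReal_nonneg hY1.symm
      have hY2' := lt_of_le_of_ne measureReal_nonneg hY2.symm
      have hs := measureReal_sdiff_of_subset (μ := μ) hYm hYC
      rw [pow_succ]
      rcases le_total (μ.real Y) (μ.real (C \ Y)) with h | h
      · exact ⟨Y, hYC.trans hCE, hYm, hY1', by linarith⟩
      · exact ⟨C \ Y, sdiff_subset.trans hCE, hCm.diff hYm, hY2', by linarith⟩
  have hlim : Tendsto (fun n : ℕ => μ.real E * (1 / 2 : ℝ) ^ n) atTop (𝓝 (μ.real E * 0)) :=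
    (tendsto_pow_atTop_nhds_zero_of_lt_one (by norm_num) (by norm_num)).const_mul _
  rw [mul_zero] at hlim
  obtain ⟨n, hn⟩ := (hlim.eventually (gt_mem_nhds hε)).exists
  obtain ⟨C, h1, h2, h3, h4⟩ := key n
  exact ⟨C, h1, h2, h3, h4.trans hn.le⟩

/-- Sierpiński's theorem: a set without atoms has subsets of every intermediate mass. -/
lemma exists_subset_measureReal_eq_of_no_atoms {N : Set Ω} (hNm : MeasurableSet N)
    (hN : ∀ Z ⊆ N, IndecomposableSet μ Z → μ.real Z = 0) {x : ℝ} (hx0 : 0 ≤ x)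
    (hx : x ≤ μ.real N) : ∃ Y ⊆ N, MeasurableSet Y ∧ μ.real Y = x := by
  obtain ⟨B, ⟨hBN, hBm, hBx⟩, hmax⟩ := exists_maximal_measure (μ := μ)
    (fun B => B ⊆ N ∧ MeasurableSet B ∧ μ.real B ≤ x) ⟨empty_subset _, MeasurableSet.empty, by simpa⟩
    (fun B hB h => ⟨iUnion_subset fun n => (h n).1, MeasurableSet.iUnion fun n => (h n).2.1,
      le_of_tendsto' (tendsto_measureReal_iUnion hB) fun n => (h n).2.2⟩)
  -- If `B` fell short of `x`, a small enough non-null piece of `N \ B` could be added, against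
  -- maximality.
  refine ⟨B, hBN, hBm, hBx.antisymm (not_lt.1 fun hlt => ?_)⟩
  have hs := measureReal_sdiff_of_subset (μ := μ) hBm hBN
  obtain ⟨C, hC, hCm, hC0, hCx⟩ := exists_subset_measureReal_le hN
    (sdiff_subset : N \ B ⊆ N) (hNm.diff hBm) (by linarith) (sub_pos.2 hlt)
  have hdisj : Disjoint B C := (disjoint_sdiff_left.mono_left hC).symm
  have hu := measureReal_union (μ := μ) hdisj hCm
  have := hmax (B ∪ C) ⟨union_subset hBN (hC.trans sdiff_subset), hBm.union hCm, by linarith⟩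
    subset_union_left
  linarith

/-! ### Kakeya's condition and the filling of intervals by sums of atoms. -/

namespace AtomExhaustion

variable {R : ℕ → Set Ω} (h : AtomExhaustion μ R)
include h

lemma measurable_iInter : MeasurableSet (⋂ n, R n) := MeasurableSet.iInter h.measurable

lemma tendsto : Tendsto (fun n => μ.real (R n)) atTop (𝓝 (μ.real (⋂ n, R n))) :=
  tendsto_measureReal_iInter h.measurable h.anti

lemma atom_eq (n : ℕ) : μ.real (R n \ R (n + 1)) = μ.real (R n) - μ.real (R (n + 1)) :=
  measureReal_sdiff_of_subset (h.measurable _) (h.anti n.le_succ)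

lemma atom_antitone : Antitone fun n => μ.real (R n \ R (n + 1)) :=
  antitone_nat_of_succ_le fun n =>
    h.largest n _ (sdiff_subset.trans (h.anti n.le_succ)) (h.indecomposable _)

lemma tendsto_atom : Tendsto (fun n => μ.real (R n \ R (n + 1))) atTop (𝓝 0) := by
  have := h.tendsto.sub (h.tendsto.comp (tendsto_add_atTop_nat 1))
  rw [sub_self] at this
  exact this.congr fun n => (h.atom_eq n).symm

lemma no_atoms_iInter : ∀ Z ⊆ ⋂ n, R n, IndecomposableSet μ Z → μ.real Z = 0 :=
  fun Z hZ hi => le_antisymm (ge_of_tendsto' h.tendsto_atom fun n =>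
    h.largest n Z (hZ.trans (iInter_subset _ n)) hi) measureReal_nonneg

lemma inter_atom (n : ℕ) {A : Set Ω} (hA : MeasurableSet A) :
    μ.real (A ∩ (R n \ R (n + 1))) = 0 ∨
      μ.real (A ∩ (R n \ R (n + 1))) = μ.real (R n \ R (n + 1)) := by
  rw [inter_comm]
  exact or_iff_not_imp_left.2 ((h.indecomposable n).inter_eq hA)

/-- Kakeya's condition. -/
lemma atom_le (hint : ∀ x, 0 ≤ x → x ≤ μ.real univ → ∃ A, MeasurableSet A ∧ μ.real A = x)
    (n : ℕ) : μ.real (R n \ R (n + 1)) ≤ μ.real (R (n + 1)) := by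
  by_contra! hlt
  -- A set of mass `v < a n` contains none of the atoms up to `n`, so it lies in `R (n + 1)` up to a
  -- null set and has mass less than `v`.
  obtain ⟨v, hv1, hv2⟩ := exists_between hlt
  obtain ⟨A, hA, rfl⟩ := hint v (measureReal_nonneg.trans hv1.le)
    (hv2.le.trans (measureReal_mono (subset_univ _)))
  have key : ∀ k ≤ n + 1, μ.real A = μ.real (A ∩ R k) := by
    intro k
    induction k with
    | zero => simp [h.zero]
    | succ k ih =>
      intro hk
      rw [ih (by omega), measureReal_inter_eq_inter_add_inter_sdiff (h.measurable (k + 1)) (h.anti k.le_succ) A]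
      rcases h.inter_atom k hA with h0 | h0
      · rw [h0, add_zero]
      · have h1 : μ.real (R n \ R (n + 1)) ≤ μ.real (R k \ R (k + 1)) :=
          h.atom_antitone (by omega : k ≤ n)
        have h2 : μ.real (A ∩ (R k \ R (k + 1))) ≤ μ.real A := measureReal_mono inter_subset_left
        linarith
  have h1 : μ.real (A ∩ R (n + 1)) ≤ μ.real (R (n + 1)) := measureReal_mono inter_subset_right
  linarith [key (n + 1) le_rfl]

/-- Greedy expansion: take an atom whenever it fits. If it does not fit, Kakeya's condition says
that the later remainder still covers the deficit. -/
lemma exists_subset_measureReal_eq (hK : ∀ n, μ.real (R n \ R (n + 1)) ≤ μ.real (R (n + 1)))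
    (n : ℕ) {x : ℝ} (hx0 : 0 ≤ x) (hx : x ≤ μ.real (R n)) :
    ∃ A ⊆ R n, MeasurableSet A ∧ μ.real A = x := by
  classical
  let B : ℕ → Set Ω := fun k => Nat.rec ∅ (fun k S =>
    if μ.real S + μ.real (R (n + k) \ R (n + k + 1)) ≤ x
    then S ∪ (R (n + k) \ R (n + k + 1)) else S) k
  have hsucc : ∀ k, B (k + 1) = if μ.real (B k) + μ.real (R (n + k) \ R (n + k + 1)) ≤ x
    then B k ∪ (R (n + k) \ R (n + k + 1)) else B k := fun k => rfl
  have hinv : ∀ k, MeasurableSet (B k) ∧ B k ⊆ R n \ R (n + k) ∧ μ.real (B k) ≤ x ∧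
      x ≤ μ.real (B k) + μ.real (R (n + k)) := by
    intro k
    induction k with
    | zero => exact ⟨MeasurableSet.empty, empty_subset _, by simpa [B], by simpa [B]⟩
    | succ k ih =>
      obtain ⟨h1, h2, h3, h4⟩ := ih
      have ha := h.atom_eq (n + k)
      have hanti : R (n + k + 1) ⊆ R (n + k) := h.anti (n + k).le_succ
      rw [hsucc, ← add_assoc]
      split_ifs with hc
      · have hd : Disjoint (B k) (R (n + k) \ R (n + k + 1)) :=
          (disjoint_sdiff_left.mono_left h2).mono_right sdiff_subset
        have hu := measureReal_union (μ := μ) hd (h.indecomposable (n + k)).1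
        refine ⟨h1.union (h.indecomposable _).1, union_subset
          (h2.trans (sdiff_subset_sdiff_right hanti))
          (sdiff_subset_sdiff_left (h.anti (Nat.le_add_right n k))), by linarith, by linarith⟩
      · exact ⟨h1, h2.trans (sdiff_subset_sdiff_right hanti), h3, by linarith [hK (n + k)]⟩
  have hmono : Monotone B := monotone_nat_of_le_succ fun k => by
    rw [hsucc]
    split_ifs
    · exact subset_union_left
    · exact subset_rfl
  have hlim := tendsto_measureReal_iUnion (μ := μ) hmono
  have hle : μ.real (⋃ k, B k) ≤ x := le_of_tendsto' hlim fun k => (hinv k).2.2.1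
  -- The deficit left by the atoms is at most the atomless mass, where Sierpiński's theorem supplies
  -- it.
  have hge : x ≤ μ.real (⋃ k, B k) + μ.real (⋂ k, R k) := by
    refine ge_of_tendsto' (hlim.add ?_) fun k => (hinv k).2.2.2
    have := h.tendsto.comp (tendsto_add_atTop_nat n)
    exact this.congr fun k => by simp [add_comm]
  obtain ⟨Y, hYN, hYm, hY⟩ := exists_subset_measureReal_eq_of_no_atoms h.measurable_iInter
    h.no_atoms_iInter (sub_nonneg.2 hle) (by linarith)
  have hd : Disjoint (⋃ k, B k) Y := by
    refine disjoint_iUnion_left.2 fun k => ?_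
    exact (disjoint_sdiff_left.mono_left (hinv k).2.1).mono_right
      (hYN.trans (iInter_subset _ _))
  refine ⟨(⋃ k, B k) ∪ Y, union_subset (iUnion_subset fun k => (hinv k).2.1.trans sdiff_subset)
    (hYN.trans (iInter_subset _ _)), (MeasurableSet.iUnion fun k => (hinv k).1).union hYm, ?_⟩
  rw [measureReal_union hd hYm, hY]
  ring

end AtomExhaustion

end Atoms

/-! ### Functions additive along a Kakeya sequence. -/

section IntervalFilling

/-- `φ` splits along the sequence `a` with tails `t`: the sequence satisfies Kakeya's condition
and `φ` is additive on sums `a n + x` with `x` at most the tail after `n`. -/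
structure SplitsAlong (φ : ℝ → ℝ) (a t : ℕ → ℝ) : Prop where
  tail : ∀ n, t n = a n + t (n + 1)
  pos : ∀ n, 0 < a n
  le_tail : ∀ n, a n ≤ t (n + 1)
  add : ∀ n x, 0 ≤ x → x ≤ t (n + 1) → φ (a n + x) = φ (a n) + φ x

namespace SplitsAlong

variable {φ : ℝ → ℝ} {a t : ℕ → ℝ}

lemma tail_pos (h : SplitsAlong φ a t) (n : ℕ) : 0 < t n := by
  linarith [h.tail n, h.pos n, h.le_tail n]

lemma map_zero (h : SplitsAlong φ a t) : φ 0 = 0 := by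
  have := h.add 0 0 le_rfl (h.tail_pos 1).le
  rw [add_zero] at this
  linarith

lemma neg (h : SplitsAlong φ a t) : SplitsAlong (fun x => -φ x) a t :=
  ⟨h.tail, h.pos, h.le_tail, fun n x h0 h1 => by rw [h.add n x h0 h1]; ring⟩

/-- By Kakeya's condition `[0, t (n + 1)]` and its translate by `a n` cover `[0, t n]`. An increment
across both is cut at `a n`; its upper part equals `φ (y - a n)` and is bounded by `hi` without
error, so `d` does not accumulate. -/
lemma growth_step (h : SplitsAlong φ a t) (n : ℕ) {i d : ℝ}
    (hi : ∀ z, 0 ≤ z → z ≤ t (n + 1) → i * z ≤ φ z)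
    (hd : ∀ x y, 0 ≤ x → x ≤ y → y ≤ t (n + 1) → i * (y - x) - d ≤ φ y - φ x) :
    ∀ x y, 0 ≤ x → x ≤ y → y ≤ t n → i * (y - x) - d ≤ φ y - φ x := by
  intro x y hx hxy hy
  have ht := h.tail n
  have hl := h.le_tail n
  have hp := h.pos n
  have hsplit : ∀ z, a n ≤ z → z ≤ t n → φ z = φ (a n) + φ (z - a n) := fun z h1 h2 => by
    rw [← h.add n (z - a n) (by linarith) (by linarith), add_sub_cancel]
  rcases le_or_gt y (t (n + 1)) with h1 | h1
  · exact hd x y hx hxy h1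
  · have hya : a n ≤ y := by linarith
    rw [hsplit y hya hy]
    rcases le_or_gt (a n) x with h2 | h2
    · rw [hsplit x h2 (by linarith)]
      have := hd (x - a n) (y - a n) (by linarith) (by linarith) (by linarith)
      linarith
    · have h3 := hd x (a n) hx h2.le hl
      have h4 := hi (y - a n) (by linarith) (by linarith)
      linarith

lemma growth_zero (h : SplitsAlong φ a t) (n : ℕ) {i : ℝ}
    (hd : ∀ x y, 0 ≤ x → x ≤ y → y ≤ t n → i * (y - x) ≤ φ y - φ x) :
    ∀ x y, 0 ≤ x → x ≤ y → y ≤ t 0 → i * (y - x) ≤ φ y - φ x := by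
  induction n with
  | zero => exact hd
  | succ n ih =>
    refine ih fun x y hx hxy hy => ?_
    have := h.growth_step n (i := i) (d := 0) (fun z h0 h1 => by
      have := hd 0 z le_rfl h0 h1
      rwa [h.map_zero, sub_zero, sub_zero] at this)
      (fun x y hx hxy hy => by simpa using hd x y hx hxy hy) x y hx hxy hy
    simpa using this

lemma tail_antitone (h : SplitsAlong φ a t) : Antitone t :=
  antitone_nat_of_succ_le fun n => by linarith [h.tail n, h.pos n]

/-- A lower bound for `φ` near zero is a lower bound for all its increments. -/
lemma growth (h : SplitsAlong φ a t) (ht : Tendsto t atTop (𝓝 0)) {b : ℕ → ℝ}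
    (hb : Tendsto b atTop (𝓝 0)) (hφ : ∀ n z, 0 ≤ z → z ≤ t n → |φ z| ≤ b n) (n : ℕ) {i : ℝ}
    (hi : ∀ z, 0 ≤ z → z ≤ t n → i * z ≤ φ z) :
    ∀ x y, 0 ≤ x → x ≤ y → y ≤ t 0 → i * (y - x) ≤ φ y - φ x := by
  refine h.growth_zero n ?_
  -- At level `m + k` the inequality holds trivially with this error, which descends unchanged to
  -- level `m` and vanishes as `k → ∞`.
  have key : ∀ k m, n ≤ m → ∀ x y, 0 ≤ x → x ≤ y → y ≤ t m →
      i * (y - x) - (2 * b (m + k) + |i| * t (m + k)) ≤ φ y - φ x := by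
    intro k
    induction k with
    | zero =>
      intro m _ x y hx hxy hy
      have h1 := abs_le.1 (hφ m x hx (hxy.trans hy))
      have h2 := abs_le.1 (hφ m y (hx.trans hxy) hy)
      have h3 : i * (y - x) ≤ |i| * t m :=
        mul_le_mul (le_abs_self i) (by linarith) (by linarith) (abs_nonneg i)
      simp only [add_zero]
      linarith
    | succ k ih =>
      intro m hm
      refine h.growth_step m (fun z h0 h1 => hi z h0 (h1.trans (h.tail_antitone (by omega)))) ?_
      have := ih (m + 1) (by omega)
      rwa [show m + 1 + k = m + (k + 1) by ring] at this
  intro x y hx hxy hy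
  have hlim : Tendsto (fun k => i * (y - x) - (2 * b (k + n) + |i| * t (k + n))) atTop
      (𝓝 (i * (y - x) - (2 * 0 + |i| * 0))) :=
    (((hb.comp (tendsto_add_atTop_nat n)).const_mul 2).add
      ((ht.comp (tendsto_add_atTop_nat n)).const_mul |i|)).const_sub _
  simp only [mul_zero, add_zero, sub_zero] at hlim
  exact le_of_tendsto' hlim fun k => by
    rw [add_comm k n]
    exact key k n le_rfl x y hx hxy hy

/-- If every point can be moved by `± a n` with the corresponding change of `φ`, then a
nonnegative `φ` has convergent ratios `φ (a n) / a n`. -/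
lemma exists_tendsto_ratio (h : SplitsAlong φ a t) (ht : Tendsto t atTop (𝓝 0)) {b : ℕ → ℝ}
    (hb : Tendsto b atTop (𝓝 0)) (hφ : ∀ n z, 0 ≤ z → z ≤ t n → |φ z| ≤ b n)
    (hnonneg : ∀ z, 0 ≤ z → z ≤ t 0 → 0 ≤ φ z)
    (hflip : ∀ n z, 0 ≤ z → z ≤ t 0 →
      φ (z + a n) - φ z = φ (a n) ∨ φ (z - a n) - φ z = -φ (a n)) :
    ∃ c, Tendsto (fun n => φ (a n) / a n) atTop (𝓝 c) := by
  have hmono : MonotoneOn φ (Icc 0 (t 0)) := by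
    intro x hx y hy hxy
    have := h.growth ht hb hφ 0 (i := 0) (by simpa using hnonneg) x y hx.1 hxy hy.2
    linarith
  have hae := hmono.ae_differentiableWithinAt_of_mem
  -- Lebesgue's theorem: a monotone function is differentiable almost everywhere.
  obtain ⟨x, hx, hdiff⟩ : ∃ x ∈ Ioo 0 (t 0), DifferentiableAt ℝ φ x := by
    by_contra! hcon
    have hnull : volume (Ioo 0 (t 0)) = 0 := by
      rw [ae_iff] at hae
      refine measure_mono_null (fun x hx => ?_) hae
      rw [mem_ofPred_eq]
      intro hd
      exact hcon x hx ((hd ⟨hx.1.le, hx.2.le⟩).differentiableAt (Icc_mem_nhds hx.1 hx.2))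
    rw [Real.volume_Ioo, ENNReal.ofReal_eq_zero] at hnull
    linarith [h.tail_pos 0]
  have ha0 : Tendsto a atTop (𝓝 0) :=
    squeeze_zero (fun n => (h.pos n).le) h.le_tail (ht.comp (tendsto_add_atTop_nat 1))
  have hslope := hasDerivAt_iff_tendsto_slope_zero.1 hdiff.hasDerivAt
  -- With `s = ± a n`, the sign given by `hflip`, the slope of `φ` at `x` is exactly `φ (a n) / a
  -- n`.
  have hsign : ∀ n, ∃ s : ℝ, s ≠ 0 ∧ |s| = a n ∧ s⁻¹ • (φ (x + s) - φ x) = φ (a n) / a n := by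
    intro n
    have hp := h.pos n
    rcases hflip n x hx.1.le hx.2.le with h1 | h1
    · exact ⟨a n, hp.ne', abs_of_pos hp, by rw [h1, smul_eq_mul]; field_simp⟩
    · refine ⟨-a n, neg_ne_zero.2 hp.ne', by rw [abs_neg, abs_of_pos hp], ?_⟩
      rw [← sub_eq_add_neg, h1, smul_eq_mul]
      field_simp
  choose s hs0 hsa hs using hsign
  have hs_lim : Tendsto s atTop (𝓝[≠] 0) := by
    refine tendsto_nhdsWithin_iff.2 ⟨?_, Eventually.of_forall hs0⟩
    exact squeeze_zero_norm (fun n => by rw [Real.norm_eq_abs, hsa n]) ha0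
  exact ⟨deriv φ x, (hslope.comp hs_lim).congr hs⟩

end SplitsAlong

end IntervalFilling

/-! ### Proportionality of the two measures. -/

section Proportional

variable {Ω : Type*} [MeasurableSpace Ω] {μ ν : Measure Ω} [IsFiniteMeasure μ]
  [IsFiniteMeasure ν] {R : ℕ → Set Ω}

/-- A measure which is a function of the measure `μ` is proportional to `μ` on a set
without `μ`-atoms. -/
lemma eq_mul_of_no_atoms {N : Set Ω} (hNm : MeasurableSet N)
    (hN : ∀ Z ⊆ N, IndecomposableSet μ Z → μ.real Z = 0)
    (hL : ∀ A B, MeasurableSet A → MeasurableSet B → μ.real A = μ.real B → ν.real A = ν.real B) :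
    ∃ c, 0 ≤ c ∧ ∀ A ⊆ N, MeasurableSet A → ν.real A = c * μ.real A := by
  have hnull : ∀ A, MeasurableSet A → μ.real A = 0 → ν.real A = 0 := fun A hA h0 => by
    rw [hL A ∅ hA .empty (by simpa), measureReal_empty]
  rcases eq_or_ne (μ.real N) 0 with h0 | h0
  · refine ⟨0, le_rfl, fun A hAN hA => ?_⟩
    rw [zero_mul, hnull A hA (le_antisymm ((measureReal_mono hAN).trans h0.le) measureReal_nonneg)]
  have hpos : 0 < μ.real N := lt_of_le_of_ne measureReal_nonneg h0.symm
  set c := ν.real N / μ.real N with hc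
  have hc0 : 0 ≤ c := div_nonneg measureReal_nonneg measureReal_nonneg
  have hcN : ν.real N = c * μ.real N := by rw [hc]; field_simp
  obtain ⟨s, hs, hs1, hs2⟩ := hahn_decomposition (c.toNNReal • μ) ν
  have hreal : ∀ A, (c.toNNReal • μ).real A = c * μ.real A := fun A => by
    rw [measureReal_nnreal_smul_apply, Real.coe_toNNReal c hc0]
  have hle : ∀ A ⊆ s, MeasurableSet A → ν.real A ≤ c * μ.real A := fun A hA hAm => by
    rw [← hreal]
    exact ENNReal.toReal_mono (measure_ne_top _ _) (hs1 A hAm hA)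
  have hge : ∀ A ⊆ sᶜ, MeasurableSet A → c * μ.real A ≤ ν.real A := fun A hA hAm => by
    rw [← hreal]
    exact ENNReal.toReal_mono (measure_ne_top _ _) (hs2 A hAm hA)
  have hμs := measureReal_eq_inter_add_sdiff (μ := μ) N hs
  have hνs := measureReal_eq_inter_add_sdiff (μ := ν) N hs
  -- The lighter Hahn piece has a copy of equal mass inside the other, where the opposite inequality
  -- holds. So one piece has ratio `c`, and the other follows from the total.
  have hsplit : ν.real (N ∩ s) = c * μ.real (N ∩ s) := by
    have h1 := hle (N ∩ s) inter_subset_right (hNm.inter hs)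
    have h2 := hge (N \ s) (fun x hx => hx.2) (hNm.diff hs)
    rcases le_total (μ.real (N ∩ s)) (μ.real (N \ s)) with h | h
    · obtain ⟨B, hB, hBm, hBe⟩ := exists_subset_measureReal_eq_of_no_atoms (hNm.diff hs)
        (fun Z hZ => hN Z (hZ.trans sdiff_subset)) measureReal_nonneg h
      have h3 := hge B (fun x hx => (hB hx).2) hBm
      rw [hBe, hL B _ hBm (hNm.inter hs) hBe] at h3
      exact le_antisymm h1 h3
    · obtain ⟨B, hB, hBm, hBe⟩ := exists_subset_measureReal_eq_of_no_atoms (hNm.inter hs)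
        (fun Z hZ => hN Z (hZ.trans inter_subset_left)) measureReal_nonneg h
      have h3 := hle B (fun x hx => (hB hx).2) hBm
      rw [hBe, hL B _ hBm (hNm.diff hs) hBe] at h3
      rw [hμs, hνs, mul_add] at hcN
      linarith
  have hsplit' : ν.real (N \ s) = c * μ.real (N \ s) := by
    rw [hμs, hνs, mul_add] at hcN
    linarith
  refine ⟨c, hc0, fun A hAN hA => ?_⟩
  have e1 := measureReal_sdiff_of_subset (μ := μ) (hA.inter hs) (inter_subset_inter_left s hAN)
  have e2 := measureReal_sdiff_of_subset (μ := ν) (hA.inter hs) (inter_subset_inter_left s hAN)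
  have e3 := measureReal_sdiff_of_subset (μ := μ) (hA.diff hs) (sdiff_subset_sdiff_left hAN)
  have e4 := measureReal_sdiff_of_subset (μ := ν) (hA.diff hs) (sdiff_subset_sdiff_left hAN)
  have i1 := hle (A ∩ s) inter_subset_right (hA.inter hs)
  have i2 := hge (A \ s) (fun x hx => hx.2) (hA.diff hs)
  have i3 := hle ((N ∩ s) \ (A ∩ s)) (fun x hx => hx.1.2) ((hNm.inter hs).diff (hA.inter hs))
  have i4 := hge ((N \ s) \ (A \ s)) (fun x hx => hx.1.2) ((hNm.diff hs).diff (hA.diff hs))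
  rw [e1, e2, mul_sub] at i3
  rw [e3, e4, mul_sub] at i4
  rw [measureReal_eq_inter_add_sdiff (μ := μ) A hs, measureReal_eq_inter_add_sdiff (μ := ν) A hs,
    mul_add]
  linarith

namespace AtomExhaustion

lemma inter_atom_of_condition (h : AtomExhaustion μ R)
    (hL : ∀ A B, MeasurableSet A → MeasurableSet B → μ.real A = μ.real B → ν.real A = ν.real B)
    (n : ℕ) {A : Set Ω} (hA : MeasurableSet A) :
    (μ.real (A ∩ (R n \ R (n + 1))) = 0 ∧ ν.real (A ∩ (R n \ R (n + 1))) = 0) ∨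
      (μ.real (A ∩ (R n \ R (n + 1))) = μ.real (R n \ R (n + 1)) ∧
        ν.real (A ∩ (R n \ R (n + 1))) = ν.real (R n \ R (n + 1))) := by
  have hm := hA.inter (h.indecomposable n).1
  rcases h.inter_atom n hA with h0 | h0
  · exact Or.inl ⟨h0, by rw [hL _ ∅ hm .empty (by simpa), measureReal_empty]⟩
  · exact Or.inr ⟨h0, hL _ _ hm (h.indecomposable n).1 h0⟩

/-- A linear inequality between `ν` and `μ` passes from the atoms and the atomless part to all
subsets. -/
lemma linear_nonneg (h : AtomExhaustion μ R)
    (hL : ∀ A B, MeasurableSet A → MeasurableSet B → μ.real A = μ.real B → ν.real A = ν.real B)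
    {p q : ℝ} {n : ℕ}
    (hX : ∀ k ≥ n, 0 ≤ p * ν.real (R k \ R (k + 1)) + q * μ.real (R k \ R (k + 1)))
    (hN : ∀ A ⊆ ⋂ k, R k, MeasurableSet A → 0 ≤ p * ν.real A + q * μ.real A) :
    ∀ A ⊆ R n, MeasurableSet A → 0 ≤ p * ν.real A + q * μ.real A := by
  intro A hAR hA
  -- Peeling off an atom removes a nonnegative amount; in the limit only the part of `A` in the
  -- atomless remainder is left.
  have key : ∀ k, p * ν.real (A ∩ R (k + n)) + q * μ.real (A ∩ R (k + n)) ≤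
      p * ν.real A + q * μ.real A := by
    intro k
    induction k with
    | zero => rw [zero_add, inter_eq_self_of_subset_left hAR]
    | succ k ih =>
      have hanti : R (k + n + 1) ⊆ R (k + n) := h.anti (k + n).le_succ
      rw [measureReal_inter_eq_inter_add_inter_sdiff (μ := μ) (h.measurable _) hanti,
        measureReal_inter_eq_inter_add_inter_sdiff (μ := ν) (h.measurable _) hanti] at ih
      rw [show k + 1 + n = k + n + 1 by ring]
      have hk := hX (k + n) (by omega)
      rcases h.inter_atom_of_condition hL (k + n) hA with ⟨h1, h2⟩ | ⟨h1, h2⟩ <;>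
        rw [h1, h2] at ih <;> linarith
  have hlim : ∀ (κ : Measure Ω) [IsFiniteMeasure κ],
      Tendsto (fun k => κ.real (A ∩ R (k + n))) atTop (𝓝 (κ.real (A ∩ ⋂ k, R k))) := by
    intro κ _
    rw [inter_iInter]
    exact (tendsto_measureReal_iInter (fun k => hA.inter (h.measurable k))
      fun i j hij => inter_subset_inter_right A (h.anti hij)).comp (tendsto_add_atTop_nat n)
  exact (hN _ inter_subset_right (hA.inter h.measurable_iInter)).trans
    (le_of_tendsto' (((hlim ν).const_mul p).add ((hlim μ).const_mul q)) key)

/-- By Kakeya's condition the atom `R n \ R (n + 1)` has the mass of some subset of `R (n + 1)`,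
hence the same ratio `c`. -/
lemma eq_mul_of_eq_mul_succ (h : AtomExhaustion μ R)
    (hK : ∀ n, μ.real (R n \ R (n + 1)) ≤ μ.real (R (n + 1)))
    (hL : ∀ A B, MeasurableSet A → MeasurableSet B → μ.real A = μ.real B → ν.real A = ν.real B)
    {c : ℝ} {n : ℕ} (hn : ∀ A ⊆ R (n + 1), MeasurableSet A → ν.real A = c * μ.real A) :
    ∀ A ⊆ R n, MeasurableSet A → ν.real A = c * μ.real A := by
  intro A hAR hA
  obtain ⟨B, hB, hBm, hBe⟩ := h.exists_subset_measureReal_eq hK (n + 1) measureReal_nonneg (hK n)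
  have hX : ν.real (R n \ R (n + 1)) = c * μ.real (R n \ R (n + 1)) := by
    rw [← hBe, ← hn B hB hBm, hL _ _ hBm (h.indecomposable n).1 hBe]
  have hanti : R (n + 1) ⊆ R n := h.anti n.le_succ
  rw [← inter_eq_self_of_subset_left hAR,
    measureReal_inter_eq_inter_add_inter_sdiff (μ := μ) (h.measurable _) hanti,
    measureReal_inter_eq_inter_add_inter_sdiff (μ := ν) (h.measurable _) hanti,
    hn _ inter_subset_right (hA.inter (h.measurable _)), mul_add]
  rcases h.inter_atom_of_condition hL n hA with ⟨h1, h2⟩ | ⟨h1, h2⟩ <;> rw [h1, h2]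
  · simp
  · rw [hX]

/-- All late atoms are lighter than the atomless part, so subsets of it match them; the finitely
many early atoms are put back one by one. -/
lemma exists_eq_mul_of_iInter_pos (h : AtomExhaustion μ R)
    (hK : ∀ n, μ.real (R n \ R (n + 1)) ≤ μ.real (R (n + 1)))
    (hL : ∀ A B, MeasurableSet A → MeasurableSet B → μ.real A = μ.real B → ν.real A = ν.real B)
    (hpos : 0 < μ.real (⋂ n, R n)) :
    ∃ c, ∀ A, MeasurableSet A → ν.real A = c * μ.real A := by
  obtain ⟨c, -, hc⟩ := eq_mul_of_no_atoms h.measurable_iInter h.no_atoms_iInter hL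
  obtain ⟨n, hn⟩ := (h.tendsto_atom.eventually (gt_mem_nhds hpos)).exists
  have hX : ∀ k ≥ n, ν.real (R k \ R (k + 1)) = c * μ.real (R k \ R (k + 1)) := by
    intro k hk
    obtain ⟨B, hB, hBm, hBe⟩ := exists_subset_measureReal_eq_of_no_atoms h.measurable_iInter
      h.no_atoms_iInter measureReal_nonneg ((h.atom_antitone hk).trans hn.le)
    rw [← hBe, ← hc B hB hBm, hL _ _ hBm (h.indecomposable k).1 hBe]
  have htail : ∀ A ⊆ R n, MeasurableSet A → ν.real A = c * μ.real A := by
    intro A hAR hA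
    have h1 := h.linear_nonneg hL (p := 1) (q := -c) (fun k hk => by rw [hX k hk]; linarith)
      (fun A hA hAm => by rw [hc A hA hAm]; linarith) A hAR hA
    have h2 := h.linear_nonneg hL (p := -1) (q := c) (fun k hk => by rw [hX k hk]; linarith)
      (fun A hA hAm => by rw [hc A hA hAm]; linarith) A hAR hA
    linarith
  have hdown : ∀ k ≤ n, ∀ A ⊆ R k, MeasurableSet A → ν.real A = c * μ.real A :=
    fun k hk => Nat.decreasingInduction
      (motive := fun k _ => ∀ A ⊆ R k, MeasurableSet A → ν.real A = c * μ.real A)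
      (fun k _ ih => h.eq_mul_of_eq_mul_succ hK hL ih) htail hk
  exact ⟨c, fun A hA => hdown 0 n.zero_le A (by simp [h.zero]) hA⟩

/-- A null atom would make all later ones null, so the remainders would stay at a constant positive
mass instead of tending to zero. -/
lemma atom_pos (h : AtomExhaustion μ R)
    (hK : ∀ n, μ.real (R n \ R (n + 1)) ≤ μ.real (R (n + 1)))
    (hnull : μ.real (⋂ n, R n) = 0) (hpos : 0 < μ.real univ) (n : ℕ) :
    0 < μ.real (R n \ R (n + 1)) := by
  have htail : ∀ n, 0 < μ.real (R n) := by
    intro n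
    induction n with
    | zero => rwa [h.zero]
    | succ n ih => linarith [hK n, h.atom_eq n]
  refine lt_of_le_of_ne measureReal_nonneg fun h0 => ?_
  have hconst : ∀ k, μ.real (R (n + k)) = μ.real (R n) := by
    intro k
    induction k with
    | zero => rfl
    | succ k ih =>
      have h1 : μ.real (R (n + k) \ R (n + k + 1)) ≤ μ.real (R n \ R (n + 1)) :=
        h.atom_antitone (Nat.le_add_right n k)
      have h2 := h.atom_eq (n + k)
      have h3 : 0 ≤ μ.real (R (n + k) \ R (n + k + 1)) := measureReal_nonneg
      rw [← add_assoc]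
      linarith
  have hlim := h.tendsto.comp (tendsto_add_atTop_nat n)
  rw [hnull] at hlim
  have := tendsto_nhds_unique hlim (tendsto_const_nhds.congr fun k => by
    simp only [Function.comp_apply]
    rw [add_comm, hconst])
  exact (htail n).ne this

lemma exists_eq_mul_of_iInter_null (h : AtomExhaustion μ R)
    (hK : ∀ n, μ.real (R n \ R (n + 1)) ≤ μ.real (R (n + 1)))
    (hL : ∀ A B, MeasurableSet A → MeasurableSet B → μ.real A = μ.real B → ν.real A = ν.real B)
    (hnull : μ.real (⋂ n, R n) = 0) (hpos : 0 < μ.real univ) :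
    ∃ c, ∀ A, MeasurableSet A → ν.real A = c * μ.real A := by
  classical
  have hν0 : ∀ A, MeasurableSet A → μ.real A = 0 → ν.real A = 0 := fun A hA h0 => by
    rw [hL A ∅ hA .empty (by simpa), measureReal_empty]
  -- The default `0` is used only off the range of `μ`, hence never on `[0, μ univ]`.
  obtain ⟨φ, hφ⟩ : ∃ φ : ℝ → ℝ, ∀ A, MeasurableSet A → φ (μ.real A) = ν.real A := by
    refine ⟨fun x => if hx : ∃ A, MeasurableSet A ∧ μ.real A = x then ν.real hx.choose else 0,
      fun A hA => ?_⟩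
    have hx : ∃ B, MeasurableSet B ∧ μ.real B = μ.real A := ⟨A, hA, rfl⟩
    simp only [dif_pos hx]
    exact hL _ _ hx.choose_spec.1 hA hx.choose_spec.2
  set a : ℕ → ℝ := fun n => μ.real (R n \ R (n + 1)) with ha
  set t : ℕ → ℝ := fun n => μ.real (R n) with ht
  have hXm : ∀ n, MeasurableSet (R n \ R (n + 1)) := fun n => (h.indecomposable n).1
  have hfill : ∀ n x, 0 ≤ x → x ≤ t n → ∃ A ⊆ R n, MeasurableSet A ∧ μ.real A = x :=
    fun n x => h.exists_subset_measureReal_eq hK n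
  have hs : SplitsAlong φ a t := by
    refine ⟨fun n => by simp only [ha, ht, h.atom_eq n]; ring, h.atom_pos hK hnull hpos, hK,
      fun n x hx0 hx => ?_⟩
    obtain ⟨A, hA, hAm, rfl⟩ := hfill (n + 1) x hx0 hx
    have hd : Disjoint (R n \ R (n + 1)) A := disjoint_sdiff_left.mono_right hA
    rw [ha, ← measureReal_union hd hAm, hφ _ ((hXm n).union hAm), hφ _ (hXm n), hφ _ hAm,
      measureReal_union hd hAm]
  have ht0 : Tendsto t atTop (𝓝 0) := hnull ▸ h.tendsto
  have hb0 : Tendsto (fun n => ν.real (R n)) atTop (𝓝 0) := by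
    have := tendsto_measureReal_iInter (μ := ν) h.measurable h.anti
    rwa [hν0 _ h.measurable_iInter hnull] at this
  have hφb : ∀ n z, 0 ≤ z → z ≤ t n → |φ z| ≤ ν.real (R n) := by
    intro n z hz0 hz
    obtain ⟨A, hA, hAm, rfl⟩ := hfill n z hz0 hz
    rw [hφ A hAm, abs_of_nonneg measureReal_nonneg]
    exact measureReal_mono hA
  obtain ⟨c, hc⟩ := hs.exists_tendsto_ratio ht0 hb0 hφb
    (fun z hz0 hz => by
      obtain ⟨A, -, hAm, rfl⟩ := hfill 0 z hz0 hz
      rw [hφ A hAm]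
      exact measureReal_nonneg)
    -- A set of mass `z` either misses the atom up to a null set, and the atom can be added, or
    -- contains it up to a null set, and it can be removed.
    (fun n z hz0 hz => by
      obtain ⟨A, -, hAm, rfl⟩ := hfill 0 z hz0 hz
      have hμA := measureReal_eq_inter_add_sdiff (μ := μ) A (hXm n)
      have hνA := measureReal_eq_inter_add_sdiff (μ := ν) A (hXm n)
      have hd : Disjoint (A \ (R n \ R (n + 1))) (R n \ R (n + 1)) := disjoint_sdiff_left
      have hdm := hAm.diff (hXm n)
      rcases h.inter_atom_of_condition hL n hAm with ⟨h1, h2⟩ | ⟨h1, h2⟩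
      · left
        rw [h1, zero_add] at hμA
        rw [h2, zero_add] at hνA
        have hu := hφ _ (hdm.union (hXm n))
        rw [measureReal_union hd (hXm n), measureReal_union hd (hXm n), ← hμA, ← hνA] at hu
        rw [hu, hφ A hAm, hφ _ (hXm n)]
        ring
      · right
        rw [h1] at hμA
        rw [h2] at hνA
        have hu := hφ _ hdm
        rw [show μ.real (A \ (R n \ R (n + 1))) = μ.real A - a n by rw [hμA]; ring] at hu
        rw [hu, hφ A hAm, hφ _ (hXm n), hνA]
        ring)
  have hN : ∀ p q : ℝ, ∀ A ⊆ ⋂ k, R k, MeasurableSet A → 0 ≤ p * ν.real A + q * μ.real A := by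
    intro p q A hA hAm
    have h0 : μ.real A = 0 := le_antisymm ((measureReal_mono hA).trans hnull.le) measureReal_nonneg
    rw [h0, hν0 A hAm h0]
    simp
  have hbounds : ∀ ε > 0, ∀ z, 0 ≤ z → z ≤ t 0 → (c - ε) * z ≤ φ z ∧ φ z ≤ (c + ε) * z := by
    intro ε hε z hz0 hz
    obtain ⟨n, hn⟩ := eventually_atTop.1 (hc.eventually (Ioo_mem_nhds (sub_lt_self c hε)
      (lt_add_of_pos_right c hε)))
    have hXb : ∀ k ≥ n, (c - ε) * a k ≤ ν.real (R k \ R (k + 1)) ∧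
        ν.real (R k \ R (k + 1)) ≤ (c + ε) * a k := by
      intro k hk
      have hk' := hn k hk
      rw [hφ _ (hXm k)] at hk'
      exact ⟨((lt_div_iff₀ (hs.pos k)).1 hk'.1).le, ((div_lt_iff₀ (hs.pos k)).1 hk'.2).le⟩
    have hlow : ∀ z, 0 ≤ z → z ≤ t n → (c - ε) * z ≤ φ z := by
      intro z hz0 hz
      obtain ⟨A, hA, hAm, rfl⟩ := hfill n z hz0 hz
      have := h.linear_nonneg hL (p := 1) (q := -(c - ε))
        (fun k hk => by linarith [(hXb k hk).1]) (hN _ _) A hA hAm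
      rw [hφ A hAm]
      linarith
    have hupp : ∀ z, 0 ≤ z → z ≤ t n → -(c + ε) * z ≤ -φ z := by
      intro z hz0 hz
      obtain ⟨A, hA, hAm, rfl⟩ := hfill n z hz0 hz
      have := h.linear_nonneg hL (p := -1) (q := c + ε)
        (fun k hk => by linarith [(hXb k hk).2]) (hN _ _) A hA hAm
      rw [hφ A hAm]
      linarith
    have g1 := hs.growth ht0 hb0 hφb n hlow 0 z le_rfl hz0 hz
    -- The upper bound is the lower bound for `-φ`, which splits along the same sequence.
    have g2 := hs.neg.growth ht0 hb0 (fun n z h0 h1 => by rw [abs_neg]; exact hφb n z h0 h1)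
      n hupp 0 z le_rfl hz0 hz
    rw [hs.map_zero] at g1 g2
    constructor <;> linarith
  refine ⟨c, fun A hA => ?_⟩
  have hA0 : μ.real A ≤ t 0 := measureReal_mono (by simp [h.zero])
  have hmul : ∀ s : ℝ, Tendsto (fun ε : ℝ => (c + s * ε) * μ.real A) (𝓝[>] 0)
      (𝓝 (c * μ.real A)) := by
    intro s
    have : Continuous fun ε : ℝ => (c + s * ε) * μ.real A := by fun_prop
    simpa using (this.tendsto 0).mono_left nhdsWithin_le_nhds
  refine le_antisymm (ge_of_tendsto (hmul 1) ?_) (le_of_tendsto (hmul (-1)) ?_) <;>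
    filter_upwards [self_mem_nhdsWithin] with ε hε
  · have := (hbounds ε hε _ measureReal_nonneg hA0).2
    rwa [hφ A hA, ← one_mul ε] at this
  · have := (hbounds ε hε _ measureReal_nonneg hA0).1
    rwa [hφ A hA, show c - ε = c + -1 * ε by ring] at this

end AtomExhaustion

theorem exists_eq_mul_of_condition
    (hint : ∀ x, 0 ≤ x → x ≤ μ.real univ → ∃ A, MeasurableSet A ∧ μ.real A = x)
    (hL : ∀ A B, MeasurableSet A → MeasurableSet B → μ.real A = μ.real B → ν.real A = ν.real B) :
    ∃ c, ∀ A, MeasurableSet A → ν.real A = c * μ.real A := by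
  obtain ⟨R, h⟩ := exists_atomExhaustion μ
  have hK := h.atom_le hint
  rcases (measureReal_nonneg (μ := μ) (s := ⋂ n, R n)).eq_or_lt with h0 | h0
  · rcases (measureReal_nonneg (μ := μ) (s := univ)).eq_or_lt with h1 | h1
    · refine ⟨0, fun A hA => ?_⟩
      have hA0 : μ.real A = 0 :=
        le_antisymm ((measureReal_mono (subset_univ A)).trans h1.ge) measureReal_nonneg
      rw [zero_mul, hL A ∅ hA .empty (by simpa), measureReal_empty]
    · exact h.exists_eq_mul_of_iInter_null hK hL h0.symm h1
  · exact h.exists_eq_mul_of_iInter_pos hK hL h0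

end Proportional

/-! ### The theorem: positive measures, then signed measures with bounded density. -/

theorem theorem2p4 {Ω : Type*} [MeasurableSpace Ω] (μ : Measure Ω)
    (hμ : IsFiniteInterval (measureRange μ)) :
    (∀ ν : Measure Ω,
      ConditionL (fun A => (μ A : EReal)) (fun A => (ν A : EReal)) →
        ∃ α : ℝ≥0, ν = α • μ) ∧
    (∀ ν : VectorMeasure Ω EReal,
      ConditionL (fun A => (μ A : EReal)) (fun A => ν A) → HasBoundedRNDeriv μ ν →
        ∃ α : ℝ, ∀ A : Set Ω, MeasurableSet A → ν A = (α : EReal) * (μ A : EReal)) := by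
  obtain ⟨hconn, M, hM⟩ := hμ
  have hfin : IsFiniteMeasure μ :=
    ⟨(hM _ ⟨univ, MeasurableSet.univ, rfl⟩).trans_lt ENNReal.coe_lt_top⟩
  have hint : ∀ x, 0 ≤ x → x ≤ μ.real univ → ∃ A, MeasurableSet A ∧ μ.real A = x := by
    intro x hx0 hx
    obtain ⟨A, hA, hAx⟩ := hconn.out (x := 0) (y := μ univ) ⟨∅, MeasurableSet.empty, measure_empty⟩
      ⟨univ, MeasurableSet.univ, rfl⟩ (show ENNReal.ofReal x ∈ Icc 0 (μ univ) from
        ⟨zero_le, ENNReal.ofReal_le_of_le_toReal hx⟩)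
    exact ⟨A, hA, by rw [measureReal_def, hAx, ENNReal.toReal_ofReal hx0]⟩
  have hmass : ∀ A B, μ.real A = μ.real B → (μ A : EReal) = μ B := fun A B hAB => by
    rw [(ENNReal.toReal_eq_toReal_iff' (measure_ne_top μ A) (measure_ne_top μ B)).1 hAB]
  have hne_top : ∀ A, (μ A : EReal) ≠ ⊤ := fun A => by
    simp
  have hne_bot : ∀ A, (μ A : EReal) ≠ ⊥ := fun A => EReal.coe_ennreal_ne_bot _
  refine ⟨fun ν hL => ?_, fun ν hL hν => ?_⟩
  · have hνfin : IsFiniteMeasure ν := ⟨by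
      have := (hL univ univ .univ .univ rfl (hne_top _) (hne_bot _)).2.1
      exact lt_top_iff_ne_top.2 (by simpa using this)⟩
    obtain ⟨c, hc⟩ := exists_eq_mul_of_condition (μ := μ) (ν := ν) hint fun A B hA hB hAB => by
      have := (hL A B hA hB (hmass A B hAB) (hne_top _) (hne_bot _)).1
      rw [measureReal_def, measureReal_def, EReal.coe_ennreal_injective this]
    refine ⟨c.toNNReal, Measure.ext fun A hA => ?_⟩
    rw [← ENNReal.toReal_eq_toReal_iff' (measure_ne_top _ _) (measure_ne_top _ _),
      ← measureReal_def, ← measureReal_def, measureReal_nnreal_smul_apply, hc A hA]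
    -- If `c ≤ 0`, then `ν A = c * μ A ≤ 0` forces `ν A = 0`, so truncating `c` at zero is harmless.
    rcases le_total 0 c with h0 | h0
    · rw [Real.coe_toNNReal c h0]
    · have h1 := hc A hA
      have h2 : 0 ≤ ν.real A := measureReal_nonneg
      have h3 : c * μ.real A ≤ 0 := mul_nonpos_of_nonpos_of_nonneg h0 measureReal_nonneg
      rw [Real.toNNReal_of_nonpos h0, NNReal.coe_zero, zero_mul]
      linarith
  · obtain ⟨g, hg, hgν⟩ := hν
    have hgi : Integrable g μ := hg.integrable le_top
    obtain ⟨K, hK⟩ : ∃ K : ℝ, ∀ᵐ x ∂μ, |g x| ≤ K :=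
      ⟨(eLpNorm g ∞ μ).toReal, by
        rw [eLpNorm_exponent_top]
        filter_upwards [enorm_ae_le_eLpNormEssSup g μ] with x hx
        have := ENNReal.toReal_mono (by simpa using hg.2.ne) hx
        rwa [toReal_enorm, Real.norm_eq_abs] at this⟩
    have hsum : Integrable (fun x => g x + K) μ := hgi.add (integrable_const K)
    have hnonneg : ∀ᵐ x ∂μ, 0 ≤ g x + K := by
      filter_upwards [hK] with x hx
      linarith [(abs_le.1 hx).1]
    -- Adding `K μ` makes the measure positive and preserves the condition; `K` is subtracted from
    -- the constant at the end.
    let ν' := μ.withDensity fun x => ENNReal.ofReal (g x + K)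
    have hν'fin : IsFiniteMeasure ν' := isFiniteMeasure_withDensity_ofReal hsum.2
    have hν' : ∀ A, MeasurableSet A → ν'.real A = ∫ x in A, g x ∂μ + K * μ.real A := by
      intro A hA
      rw [measureReal_def, withDensity_apply _ hA,
        ← integral_eq_lintegral_of_nonneg_ae (ae_restrict_of_ae hnonneg)
          hsum.aestronglyMeasurable.restrict,
        integral_add hgi.integrableOn (integrable_const K), setIntegral_const, smul_eq_mul,
        mul_comm K]
    obtain ⟨c, hc⟩ := exists_eq_mul_of_condition (μ := μ) (ν := ν') hint fun A B hA hB hAB => by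
      have := (hL A B hA hB (hmass A B hAB) (hne_top _) (hne_bot _)).1
      simp only [hgν A hA, hgν B hB, EReal.coe_eq_coe_iff] at this
      rw [hν' A hA, hν' B hB, this, hAB]
    refine ⟨c - K, fun A hA => ?_⟩
    have h1 := hc A hA
    rw [hν' A hA] at h1
    rw [hgν A hA, ← EReal.coe_ennreal_toReal (measure_ne_top μ A), ← EReal.coe_mul,
      ← measureReal_def]
    congr 1
    linarith
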